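/- **Proposition 2 (Adaptation outside the barrier).** Write $\lfloor x\rceil^{a}=|x|^{a}\operatorname{sgn}(x)$. Consider the perturbed integrator $\dot s=u+d(t)$ with the super-twisting controller $u=-k_1\lfloor s\rceil^{\alpha}+v$, $\dot v=-k_2\lfloor s\rceil^{0}$. With $\varphi=v+d$ and $\delta=\dot d$ the closed loop is $$\dot s=-k_1\lfloor s\rceil^{\alpha}+\varphi,\qquad \dot\varphi=-k_2\lfloor s\rceil^{0}+\delta(t),$$ where $\alpha\in(0,1)$ and $|\delta(t)|\le\Delta$ for all $t\ge 0$, for some constant $\Delta\ge 0$ ($\Delta=0$ is the unperturbed case). Let $\varepsilon>0$ and let the gains, with $k_1(0)>0$ and $k_2(0)>0$, obey $$\dot k_1=\begin{cases}\dfrac{k_1}{|\dot s|} & \text{if } |s|\ge\varepsilon,\\[1ex] -k_1&\text{otherwise,}\end{cases}\qquad \dot k_2=\begin{cases}\dfrac{k_2}{2|s|^{1-\alpha}} & \text{if } |s|\ge\varepsilon,\\[1ex] -k_2&\text{otherwise.}\end{cases}$$ A trajectory on $[0,T]$ is a quadruple $(s,\varphi,k_1,k_2)$ of absolutely continuous functions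 satisfying these equations for almost every $t\in[0,T]$, where $\operatorname{sgn}(0)$ may take any value in $[-1,1]$ (Filippov) and where $\dot s\neq 0$ for almost every $t$ with $|s(t)|\ge\varepsilon$. Then the trajectories reach the barrier set $|s|<\varepsilon$ in finite time, where in the case that both $\Delta>0$ and $\alpha<\tfrac12$ it is assumed in addition that $\dot s$ stays bounded outside the barrier set. Precisely: for all $\alpha,\varepsilon,\Delta$ as above, all initial values $s(0),\varphi(0)\in\mathbb R$, $k_1(0),k_2(0)>0$ and every $M\in\mathbb R$ there is a $T\ge 0$ such that for every $\delta$ with $|\delta|\le\Delta$, every trajectory on $[0,T]$ with these initial values which, if $\Delta>0$ and $\alpha<\tfrac12$, satisfies $|\dot s(t)|\le M$ for all $t\in[0,T]$ with $|s(t)|\ge\varepsilon$, has $|s(t)|<\varepsilon$ for some $t\in[0,T]$. (If $\Delta=0$ or $\alpha\ge\tfrac12$, the number $M$ plays no role.) -/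

import Mathlib

open Set MeasureTheory

/-- The signed power `⌊x⌉^a = |x|^a sgn x`. -/
noncomputable def signedPow (x a : ℝ) : ℝ := |x| ^ a * Real.sign x

/-- Filippov's set-valued sign: the regularization of `⌊x⌉^0 = sgn x`. -/
def filippovSign (x : ℝ) : Set ℝ :=
  {σ | (0 < x → σ = 1) ∧ (x < 0 → σ = -1) ∧ -1 ≤ σ ∧ σ ≤ 1}

/-- The right-hand side `-k₁ ⌊s⌉^α + φ` of the equation for `ṡ`. -/
noncomputable def slidingRate (α s φ k₁ : ℝ) : ℝ := -k₁ * signedPow s α + φ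

/-- `(s, φ, k₁, k₂)` is on `[0, T]` a trajectory of the super-twisting closed loop with perturbation
rate `δ` and adaptive gains: the four functions are absolutely continuous on `[0, T]`, and for
almost every `t ∈ [0, T]`
* `ṡ = -k₁ ⌊s⌉^α + φ`,
* `φ̇ ∈ -k₂ Sgn(s) + δ(t)` (Filippov),
* `k̇₁ = k₁ / |ṡ|` (with `ṡ ≠ 0`, so that the quotient makes sense) if `|s| ≥ ε`,
  `k̇₁ = -k₁` otherwise,
* `k̇₂ = k₂ / (2 |s|^(1-α))` if `|s| ≥ ε`, `k̇₂ = -k₂` otherwise. -/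
structure IsAdaptiveTrajectory (α ε : ℝ) (δ : ℝ → ℝ) (T : ℝ) (s φ k₁ k₂ : ℝ → ℝ) : Prop where
  ac_s : AbsolutelyContinuousOnInterval s 0 T
  ac_φ : AbsolutelyContinuousOnInterval φ 0 T
  ac_k₁ : AbsolutelyContinuousOnInterval k₁ 0 T
  ac_k₂ : AbsolutelyContinuousOnInterval k₂ 0 T
  deriv_s : ∀ᵐ t : ℝ, t ∈ Icc 0 T → HasDerivAt s (slidingRate α (s t) (φ t) (k₁ t)) t
  deriv_φ : ∀ᵐ t : ℝ, t ∈ Icc 0 T →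
    ∃ σ ∈ filippovSign (s t), HasDerivAt φ (-k₂ t * σ + δ t) t
  deriv_k₁_outside : ∀ᵐ t : ℝ, t ∈ Icc 0 T → ε ≤ |s t| →
    slidingRate α (s t) (φ t) (k₁ t) ≠ 0 ∧
      HasDerivAt k₁ (k₁ t / |slidingRate α (s t) (φ t) (k₁ t)|) t
  deriv_k₁_inside : ∀ᵐ t : ℝ, t ∈ Icc 0 T → |s t| < ε → HasDerivAt k₁ (-k₁ t) t
  deriv_k₂_outside : ∀ᵐ t : ℝ, t ∈ Icc 0 T → ε ≤ |s t| →
    HasDerivAt k₂ (k₂ t / (2 * |s t| ^ (1 - α))) t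
  deriv_k₂_inside : ∀ᵐ t : ℝ, t ∈ Icc 0 T → |s t| < ε → HasDerivAt k₂ (-k₂ t) t

/-- Comparison principle: an absolutely continuous function whose derivative is almost everywhere at
most `g'` grows at most as much as a primitive `g` of `g'`. -/
theorem AbsolutelyContinuousOnInterval.sub_le_sub_of_ae_deriv_le {f g g' : ℝ → ℝ} {a b : ℝ}
    (hab : a ≤ b) (hf : AbsolutelyContinuousOnInterval f a b)
    (hg : ∀ t ∈ Icc a b, HasDerivAt g (g' t) t) (hg' : ContinuousOn g' (Icc a b))
    (h : ∀ᵐ t : ℝ, t ∈ Icc a b → ∃ d, HasDerivAt f d t ∧ d ≤ g' t) :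
    f b - f a ≤ g b - g a := by
  have hint : IntervalIntegrable g' volume a b := by
    rw [← uIcc_of_le hab] at hg'
    exact hg'.intervalIntegrable
  rw [← hf.integral_deriv_eq_sub,
    ← intervalIntegral.integral_eq_sub_of_hasDerivAt (by rwa [uIcc_of_le hab]) hint]
  refine intervalIntegral.integral_mono_ae_restrict hab hf.intervalIntegrable_deriv hint ?_
  rw [Filter.EventuallyLE, ae_restrict_iff' measurableSet_Icc]
  filter_upwards [h] with t ht hmem
  obtain ⟨d, hd, hle⟩ := ht hmem
  rwa [hd.deriv]

theorem AbsolutelyContinuousOnInterval.sub_le_sub_of_le_ae_deriv {f g g' : ℝ → ℝ} {a b : ℝ}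
    (hab : a ≤ b) (hf : AbsolutelyContinuousOnInterval f a b)
    (hg : ∀ t ∈ Icc a b, HasDerivAt g (g' t) t) (hg' : ContinuousOn g' (Icc a b))
    (h : ∀ᵐ t : ℝ, t ∈ Icc a b → ∃ d, HasDerivAt f d t ∧ g' t ≤ d) :
    g b - g a ≤ f b - f a := by
  have key := hf.neg.sub_le_sub_of_ae_deriv_le (g := -g) (g' := -g') hab
    (fun t ht => (hg t ht).neg) hg'.neg (by
      filter_upwards [h] with t ht hmem
      obtain ⟨d, hd, hle⟩ := ht hmem
      exact ⟨-d, hd.neg, neg_le_neg hle⟩)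
  simp only [Pi.neg_apply] at key
  linarith

theorem AbsolutelyContinuousOnInterval.mono_Icc {f : ℝ → ℝ} {a b c d : ℝ}
    (hf : AbsolutelyContinuousOnInterval f a b) (hac : a ≤ c) (hcd : c ≤ d) (hdb : d ≤ b) :
    AbsolutelyContinuousOnInterval f c d := by
  refine hf.mono ?_
  rw [uIcc_of_le hcd, uIcc_of_le (hac.trans (hcd.trans hdb))]
  exact Icc_subset_Icc hac hdb

/-- A solution of `ḟ = c f` with `c ≥ 0` that starts at a positive value never falls below it. -/
theorem AbsolutelyContinuousOnInterval.le_of_ae_hasDerivAt_mul {f : ℝ → ℝ} {a b t : ℝ}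
    (hf : AbsolutelyContinuousOnInterval f a b) (ha : 0 < f a)
    (h : ∀ᵐ t : ℝ, t ∈ Icc a b → ∃ c, 0 ≤ c ∧ HasDerivAt f (f t * c) t) (ht : t ∈ Icc a b) :
    f a ≤ f t := by
  have hsq : ∀ u ∈ Icc a b, f a ^ 2 ≤ f u ^ 2 := by
    intro u hu
    have hfu := hf.mono_Icc le_rfl hu.1 hu.2
    have key := (hfu.mul hfu).sub_le_sub_of_le_ae_deriv (g := fun _ => 0) (g' := fun _ => 0) hu.1
      (fun _ _ => hasDerivAt_const _ _) continuousOn_const (by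
        filter_upwards [h] with v hv hmem
        obtain ⟨c, hc, hd⟩ := hv ⟨hmem.1, hmem.2.trans hu.2⟩
        refine ⟨_, hd.mul hd, ?_⟩
        nlinarith [mul_nonneg (mul_self_nonneg (f v)) hc])
    simp only [Pi.mul_apply] at key
    nlinarith
  have hpos : 0 < f t := by
    by_contra! hneg
    have hcont : ContinuousOn f (Icc a t) := by
      have := (hf.mono_Icc le_rfl ht.1 ht.2).continuousOn
      rwa [uIcc_of_le ht.1] at this
    obtain ⟨u, hu, hu0⟩ := intermediate_value_Icc' ht.1 hcont ⟨hneg, ha.le⟩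
    have := hsq u ⟨hu.1, hu.2.trans ht.2⟩
    rw [hu0] at this
    nlinarith
  exact (sq_le_sq₀ ha.le hpos.le).mp (hsq t ht)

theorem signedPow_neg (x a : ℝ) : signedPow (-x) a = -signedPow x a := by
  simp [signedPow, Real.sign_neg]

theorem slidingRate_neg (α s φ k₁ : ℝ) :
    slidingRate α (-s) (-φ) k₁ = -slidingRate α s φ k₁ := by
  simp only [slidingRate, signedPow_neg]; ring

theorem neg_mem_filippovSign_neg {x σ : ℝ} (h : σ ∈ filippovSign x) :
    -σ ∈ filippovSign (-x) := by
  obtain ⟨hpos, hneg, hlo, hhi⟩ := h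
  refine ⟨fun hx => ?_, fun hx => ?_, by linarith, by linarith⟩
  · rw [hneg (by linarith)]; norm_num
  · rw [hpos (by linarith)]

/-- The closed loop is invariant under the point reflection `(s, φ, δ) ↦ (-s, -φ, -δ)`. -/
theorem IsAdaptiveTrajectory.neg {α ε T : ℝ} {δ s φ k₁ k₂ : ℝ → ℝ}
    (h : IsAdaptiveTrajectory α ε δ T s φ k₁ k₂) :
    IsAdaptiveTrajectory α ε (-δ) T (-s) (-φ) k₁ k₂ where
  ac_s := h.ac_s.neg
  ac_φ := h.ac_φ.neg
  ac_k₁ := h.ac_k₁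
  ac_k₂ := h.ac_k₂
  deriv_s := by
    filter_upwards [h.deriv_s] with t ht hmem
    simpa only [Pi.neg_apply, slidingRate_neg] using (ht hmem).neg
  deriv_φ := by
    filter_upwards [h.deriv_φ] with t ht hmem
    obtain ⟨σ, hσ, hd⟩ := ht hmem
    refine ⟨-σ, neg_mem_filippovSign_neg hσ, ?_⟩
    exact hd.neg.congr_deriv (by rw [Pi.neg_apply]; ring)
  deriv_k₁_outside := by
    simpa only [Pi.neg_apply, slidingRate_neg, abs_neg, neg_ne_zero] using h.deriv_k₁_outside
  deriv_k₁_inside := by simpa only [Pi.neg_apply, abs_neg] using h.deriv_k₁_inside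
  deriv_k₂_outside := by simpa only [Pi.neg_apply, abs_neg] using h.deriv_k₂_outside
  deriv_k₂_inside := by simpa only [Pi.neg_apply, abs_neg] using h.deriv_k₂_inside

namespace IsAdaptiveTrajectory

variable {α ε Δ T : ℝ} {δ s φ k₁ k₂ : ℝ → ℝ}

theorem k₁_pos (h : IsAdaptiveTrajectory α ε δ T s φ k₁ k₂) (hout : ∀ t ∈ Icc 0 T, ε ≤ |s t|)
    (hk₁ : 0 < k₁ 0) {t : ℝ} (ht : t ∈ Icc 0 T) : 0 < k₁ t := by
  refine hk₁.trans_le (h.ac_k₁.le_of_ae_hasDerivAt_mul hk₁ ?_ ht)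
  filter_upwards [h.deriv_k₁_outside] with u hu hmem
  refine ⟨|slidingRate α (s u) (φ u) (k₁ u)|⁻¹, by positivity, ?_⟩
  simpa only [div_eq_mul_inv] using (hu hmem (hout u hmem)).2

theorem le_k₂ (h : IsAdaptiveTrajectory α ε δ T s φ k₁ k₂) (hout : ∀ t ∈ Icc 0 T, ε ≤ |s t|)
    (hk₂ : 0 < k₂ 0) {t : ℝ} (ht : t ∈ Icc 0 T) : k₂ 0 ≤ k₂ t := by
  refine h.ac_k₂.le_of_ae_hasDerivAt_mul hk₂ ?_ ht
  filter_upwards [h.deriv_k₂_outside] with u hu hmem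
  refine ⟨(2 * |s u| ^ (1 - α))⁻¹, by positivity, ?_⟩
  simpa only [div_eq_mul_inv] using hu hmem (hout u hmem)

theorem deriv_s_le (h : IsAdaptiveTrajectory α ε δ T s φ k₁ k₂) (hε : 0 < ε)
    (hout : ∀ t ∈ Icc 0 T, ε ≤ s t) (hk₁ : 0 < k₁ 0) {t : ℝ} (ht : t ∈ Icc 0 T) :
    slidingRate α (s t) (φ t) (k₁ t) ≤ φ t := by
  have hk := h.k₁_pos (fun u hu => (hout u hu).trans (le_abs_self _)) hk₁ ht
  have hs : 0 < s t := hε.trans_le (hout t ht)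
  have : 0 ≤ signedPow (s t) α := by
    rw [signedPow, Real.sign_of_pos hs]; positivity
  unfold slidingRate
  nlinarith [mul_nonneg hk.le this]

theorem ae_hasDerivAt_φ_le (h : IsAdaptiveTrajectory α ε δ T s φ k₁ k₂) (hε : 0 < ε)
    (hδ : ∀ t, 0 ≤ t → |δ t| ≤ Δ) (hout : ∀ t ∈ Icc 0 T, ε ≤ s t) :
    ∀ᵐ t : ℝ, t ∈ Icc 0 T → ∃ d, HasDerivAt φ d t ∧ d ≤ Δ - k₂ t := by
  filter_upwards [h.deriv_φ] with t ht hmem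
  obtain ⟨σ, hσ, hd⟩ := ht hmem
  refine ⟨_, hd, ?_⟩
  rw [hσ.1 (hε.trans_le (hout t hmem))]
  linarith [le_of_abs_le (hδ t hmem.1)]

/-- If `k₂ ≥ Δ + c` on `[a, b]`, then `φ` falls there with rate at least `c`. -/
theorem φ_le (h : IsAdaptiveTrajectory α ε δ T s φ k₁ k₂) (hε : 0 < ε)
    (hδ : ∀ t, 0 ≤ t → |δ t| ≤ Δ) (hout : ∀ t ∈ Icc 0 T, ε ≤ s t) {a b c : ℝ} (ha : 0 ≤ a)
    (hab : a ≤ b) (hb : b ≤ T) (hk : ∀ t ∈ Icc a b, Δ + c ≤ k₂ t) :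
    φ b ≤ φ a - c * (b - a) := by
  have key := (h.ac_φ.mono_Icc ha hab hb).sub_le_sub_of_ae_deriv_le (g := fun t => -c * t)
    (g' := fun _ => -c) hab (fun t _ => by simpa using (hasDerivAt_id t).const_mul (-c))
    continuousOn_const (by
      filter_upwards [h.ae_hasDerivAt_φ_le hε hδ hout] with t ht hmem
      obtain ⟨d, hd, hle⟩ := ht ⟨ha.trans hmem.1, hmem.2.trans hb⟩
      exact ⟨d, hd, by linarith [hk t hmem]⟩)
  linarith

/-- If `k₂ ≥ Δ + c` on `[a, b]`, then `s` stays there below a parabola of curvature `-c`. -/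
theorem s_le (h : IsAdaptiveTrajectory α ε δ T s φ k₁ k₂) (hε : 0 < ε)
    (hδ : ∀ t, 0 ≤ t → |δ t| ≤ Δ) (hout : ∀ t ∈ Icc 0 T, ε ≤ s t) (hk₁ : 0 < k₁ 0) {a b c : ℝ}
    (ha : 0 ≤ a) (hab : a ≤ b) (hb : b ≤ T) (hk : ∀ t ∈ Icc a b, Δ + c ≤ k₂ t) :
    s b ≤ s a + φ a * (b - a) - c * (b - a) ^ 2 / 2 := by
  have key := (h.ac_s.mono_Icc ha hab hb).sub_le_sub_of_ae_deriv_le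
    (g := fun t => φ a * (t - a) - c * (t - a) ^ 2 / 2)
    (g' := fun t => φ a - c * (t - a)) hab
    (fun t _ => by
      have h1 : HasDerivAt (fun t : ℝ => t - a) 1 t := (hasDerivAt_id t).sub_const a
      exact ((h1.const_mul (φ a)).sub (((h1.pow 2).const_mul c).div_const 2)).congr_deriv
        (by norm_num; ring))
    (by fun_prop) (by
      filter_upwards [h.deriv_s] with t ht hmem
      have hmem' : t ∈ Icc 0 T := ⟨ha.trans hmem.1, hmem.2.trans hb⟩
      exact ⟨_, ht hmem', (h.deriv_s_le hε hout hk₁ hmem').trans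
        (h.φ_le hε hδ hout ha hmem.1 hmem'.2 fun u hu => hk u ⟨hu.1, hu.2.trans hmem.2⟩)⟩)
  simp only [sub_self] at key
  linarith

/-- If `s ^ (1 - α)` grows at most linearly, then `k₂` grows at least logarithmically. -/
theorem log_le_k₂ (h : IsAdaptiveTrajectory α ε δ T s φ k₁ k₂) (hε : 0 < ε)
    (hout : ∀ t ∈ Icc 0 T, ε ≤ s t) (hk₂ : 0 < k₂ 0) {B : ℝ}
    (hs : ∀ t ∈ Icc 0 T, s t ^ (1 - α) ≤ B * (1 + t)) {t : ℝ} (ht : t ∈ Icc 0 T) :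
    k₂ 0 + k₂ 0 / (2 * B) * Real.log (1 + t) ≤ k₂ t := by
  have hout' : ∀ u ∈ Icc 0 T, ε ≤ |s u| := fun u hu => (hout u hu).trans (le_abs_self _)
  have key := (h.ac_k₂.mono_Icc le_rfl ht.1 ht.2).sub_le_sub_of_le_ae_deriv
    (g := fun t => k₂ 0 / (2 * B) * Real.log (1 + t))
    (g' := fun t => k₂ 0 / (2 * B) * (1 + t)⁻¹) ht.1
    (fun u hu => by
      have h1 : HasDerivAt (fun t : ℝ => 1 + t) 1 u := (hasDerivAt_id u).const_add 1
      have := h1.log (by linarith [hu.1])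
      simpa using this.const_mul (k₂ 0 / (2 * B)))
    (by
      refine continuousOn_const.mul (ContinuousOn.inv₀ (by fun_prop) fun u hu => ?_)
      linarith [hu.1]) (by
      filter_upwards [h.deriv_k₂_outside] with u hu hmem
      have hmem' : u ∈ Icc 0 T := ⟨hmem.1, hmem.2.trans ht.2⟩
      refine ⟨_, hu hmem' (hout' u hmem'), ?_⟩
      have hsu : 0 < s u := hε.trans_le (hout u hmem')
      have hpow : 0 < s u ^ (1 - α) := Real.rpow_pos_of_pos hsu _
      rw [abs_of_pos hsu, ← div_eq_mul_inv, div_div, mul_assoc]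
      have hk := h.le_k₂ hout' hk₂ hmem'
      gcongr
      · exact hk₂.le.trans hk
      · exact hs u hmem')
  simp only [add_zero, Real.log_one, mul_zero] at key
  linarith

/-- Outside the barrier set `s ^ (1 - α)` grows at most linearly. -/
theorem s_rpow_le (h : IsAdaptiveTrajectory α ε δ T s φ k₁ k₂) (hε : 0 < ε) (hα₀ : 0 < α)
    (hα₁ : α < 1) (hΔ : 0 ≤ Δ) (hδ : ∀ t, 0 ≤ t → |δ t| ≤ Δ) (hout : ∀ t ∈ Icc 0 T, ε ≤ s t)
    (hk₁ : 0 < k₁ 0) (hk₂ : 0 < k₂ 0) {M : ℝ}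
    (hM : α < 1 / 2 → ∀ t ∈ Icc 0 T, |slidingRate α (s t) (φ t) (k₁ t)| ≤ M) {t : ℝ}
    (ht : t ∈ Icc 0 T) :
    s t ^ (1 - α) ≤ (1 + |s 0| + |φ 0| + Δ + |M|) * (1 + t) := by
  have hst : 0 < s t := hε.trans_le (hout t ht)
  have ht0 := ht.1
  have hB1 : 1 ≤ 1 + |s 0| + |φ 0| + Δ + |M| := by
    linarith [abs_nonneg (s 0), abs_nonneg (φ 0), abs_nonneg M]
  rcases lt_or_ge α (1 / 2) with hα | hα
  · have hlin : s t ≤ (1 + |s 0| + |φ 0| + Δ + |M|) * (1 + t) := by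
      have key := (h.ac_s.mono_Icc le_rfl ht.1 ht.2).sub_le_sub_of_ae_deriv_le
        (g := fun t => M * t) (g' := fun _ => M) ht.1
        (fun u _ => by simpa using (hasDerivAt_id u).const_mul M)
        continuousOn_const (by
          filter_upwards [h.deriv_s] with u hu hmem
          have hmem' : u ∈ Icc 0 T := ⟨hmem.1, hmem.2.trans ht.2⟩
          exact ⟨_, hu hmem', le_of_abs_le (hM hα u hmem')⟩)
      have h1 := le_abs_self (s 0)
      have h2 : M * t ≤ |M| * t := by gcongr; exact le_abs_self M
      have h3 : 0 ≤ (1 + |s 0| + |φ 0| + Δ) * t := by positivity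
      nlinarith [abs_nonneg (φ 0), abs_nonneg M]
    calc s t ^ (1 - α) ≤ ((1 + |s 0| + |φ 0| + Δ + |M|) * (1 + t)) ^ (1 - α) := by
          gcongr
      _ ≤ ((1 + |s 0| + |φ 0| + Δ + |M|) * (1 + t)) ^ (1 : ℝ) :=
          Real.rpow_le_rpow_of_exponent_le (by nlinarith) (by linarith)
      _ = _ := Real.rpow_one _
  · have hquad : s t ≤ ((1 + |s 0| + |φ 0| + Δ + |M|) * (1 + t)) ^ 2 := by
      have key := h.s_le hε hδ hout hk₁ le_rfl ht.1 ht.2 (c := -Δ) fun u hu => by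
        have := h.le_k₂ (fun u hu => (hout u hu).trans (le_abs_self _)) hk₂
          (t := u) ⟨hu.1, hu.2.trans ht.2⟩
        linarith
      have h1 := le_abs_self (s 0)
      have h2 : φ 0 * t ≤ |φ 0| * t := by gcongr; exact le_abs_self _
      have h3 : s t ≤ (1 + |s 0| + |φ 0| + Δ + |M|) * (1 + t) ^ 2 := by
        have e : (1 + |s 0| + |φ 0| + Δ + |M|) * (1 + t) ^ 2
            = (|s 0| + |φ 0| * t + Δ * t ^ 2 / 2) + ((1 + |M|) * (1 + t) ^ 2
              + |s 0| * (2 * t + t ^ 2) + |φ 0| * (1 + t + t ^ 2)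
              + Δ * (1 + 2 * t + t ^ 2 / 2)) := by ring
        have : 0 ≤ (1 + |M|) * (1 + t) ^ 2
              + |s 0| * (2 * t + t ^ 2) + |φ 0| * (1 + t + t ^ 2)
              + Δ * (1 + 2 * t + t ^ 2 / 2) := by positivity
        rw [e]
        linarith
      refine h3.trans ?_
      rw [mul_pow]
      gcongr
      nlinarith
    have hX : 1 ≤ (1 + |s 0| + |φ 0| + Δ + |M|) * (1 + t) := by nlinarith
    calc s t ^ (1 - α) ≤ (((1 + |s 0| + |φ 0| + Δ + |M|) * (1 + t)) ^ 2) ^ (1 - α) := by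
          gcongr
      _ ≤ (((1 + |s 0| + |φ 0| + Δ + |M|) * (1 + t)) ^ 2) ^ (1 / 2 : ℝ) :=
          Real.rpow_le_rpow_of_exponent_le (one_le_pow₀ hX) (by linarith)
      _ = _ := by
          rw [← Real.sqrt_eq_rpow, Real.sqrt_sq (by linarith)]

end IsAdaptiveTrajectory

/-- A time from which on `k₂` dominates the perturbation, for trajectories outside the barrier. -/
noncomputable def dominationTime (Δ s₀ φ₀ k₂₀ M : ℝ) : ℝ :=
  Real.exp (2 * (1 + |s₀| + |φ₀| + Δ + |M|) * Δ / k₂₀) - 1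

theorem dominationTime_nonneg {Δ k₂₀ : ℝ} (s₀ φ₀ M : ℝ) (hΔ : 0 ≤ Δ) (hk₂₀ : 0 < k₂₀) :
    0 ≤ dominationTime Δ s₀ φ₀ k₂₀ M := by
  rw [dominationTime, sub_nonneg]
  exact Real.one_le_exp (by positivity)

/-- A time by which every trajectory has visited the barrier set. -/
noncomputable def reachingTime (Δ s₀ φ₀ k₂₀ M : ℝ) : ℝ :=
  dominationTime Δ s₀ φ₀ k₂₀ M
    + (2 * (|φ₀| + Δ * dominationTime Δ s₀ φ₀ k₂₀ M + 1) / k₂₀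
      + (|s₀| + |φ₀| * dominationTime Δ s₀ φ₀ k₂₀ M
        + Δ * dominationTime Δ s₀ φ₀ k₂₀ M ^ 2 / 2))

theorem dominationTime_le_reachingTime {Δ k₂₀ : ℝ} (s₀ φ₀ M : ℝ) (hΔ : 0 ≤ Δ) (hk₂₀ : 0 < k₂₀) :
    dominationTime Δ s₀ φ₀ k₂₀ M ≤ reachingTime Δ s₀ φ₀ k₂₀ M := by
  have := dominationTime_nonneg s₀ φ₀ M hΔ hk₂₀
  exact le_add_of_nonneg_right (by positivity)

/-- No trajectory stays in `s ≥ ε` up to the reaching time. -/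
theorem IsAdaptiveTrajectory.not_forall_le {α ε Δ M : ℝ} {δ s φ k₁ k₂ : ℝ → ℝ}
    (h : IsAdaptiveTrajectory α ε δ (reachingTime Δ (s 0) (φ 0) (k₂ 0) M) s φ k₁ k₂)
    (hα₀ : 0 < α) (hα₁ : α < 1) (hε : 0 < ε) (hΔ : 0 ≤ Δ) (hδ : ∀ t, 0 ≤ t → |δ t| ≤ Δ)
    (hk₁ : 0 < k₁ 0) (hk₂ : 0 < k₂ 0)
    (hM : 0 < Δ → α < 1 / 2 → ∀ t ∈ Icc 0 (reachingTime Δ (s 0) (φ 0) (k₂ 0) M),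
      ε ≤ |s t| → |slidingRate α (s t) (φ t) (k₁ t)| ≤ M) :
    ¬ ∀ t ∈ Icc 0 (reachingTime Δ (s 0) (φ 0) (k₂ 0) M), ε ≤ s t := by
  intro hout
  have hout' := fun u hu => (hout u hu).trans (le_abs_self _)
  have hdom : ∀ t ∈ Icc (dominationTime Δ (s 0) (φ 0) (k₂ 0) M)
      (reachingTime Δ (s 0) (φ 0) (k₂ 0) M), Δ + k₂ 0 ≤ k₂ t := by
    intro t ht
    have hD := dominationTime_nonneg (s 0) (φ 0) M hΔ hk₂
    have ht' : t ∈ Icc 0 (reachingTime Δ (s 0) (φ 0) (k₂ 0) M) := ⟨hD.trans ht.1, ht.2⟩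
    rcases hΔ.eq_or_lt with hΔ0 | hΔpos
    · rw [← hΔ0, zero_add]
      exact h.le_k₂ hout' hk₂ ht'
    have hlog := h.log_le_k₂ hε hout hk₂
      (fun u hu => h.s_rpow_le hε hα₀ hα₁ hΔ hδ hout hk₁ hk₂
        (fun hα v hv => hM hΔpos hα v hv (hout' v hv)) hu) ht'
    have hB : 0 < 1 + |s 0| + |φ 0| + Δ + |M| := by positivity
    have hle : 2 * (1 + |s 0| + |φ 0| + Δ + |M|) * Δ / k₂ 0 ≤ Real.log (1 + t) := by
      rw [Real.le_log_iff_exp_le (by linarith [ht'.1])]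
      have := ht.1
      rw [dominationTime] at this
      linarith
    have hmul : Δ = k₂ 0 / (2 * (1 + |s 0| + |φ 0| + Δ + |M|))
        * (2 * (1 + |s 0| + |φ 0| + Δ + |M|) * Δ / k₂ 0) := by
      generalize 1 + |s 0| + |φ 0| + Δ + |M| = B at hB
      field_simp
    have : Δ ≤ k₂ 0 / (2 * (1 + |s 0| + |φ 0| + Δ + |M|)) * Real.log (1 + t) := by
      refine hmul.le.trans ?_
      gcongr
    linarith
  have hD := dominationTime_nonneg (s 0) (φ 0) M hΔ hk₂
  have hDR := dominationTime_le_reachingTime (s 0) (φ 0) M hΔ hk₂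
  obtain ⟨R, hR⟩ : ∃ R, R = reachingTime Δ (s 0) (φ 0) (k₂ 0) M := ⟨_, rfl⟩
  rw [← hR] at h hM hout hout' hdom hDR
  rw [reachingTime] at hR
  generalize dominationTime Δ (s 0) (φ 0) (k₂ 0) M = D at *
  have hk : ∀ t ∈ Icc 0 D, Δ + -Δ ≤ k₂ t := fun t ht => by
    have := h.le_k₂ hout' hk₂ (t := t) ⟨ht.1, ht.2.trans hDR⟩
    linarith
  have hφD := h.φ_le hε hδ hout le_rfl hD hDR hk
  have hsD := h.s_le hε hδ hout hk₁ le_rfl hD hDR hk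
  have hsR := h.s_le hε hδ hout hk₁ hD hDR le_rfl hdom
  have hεR := hout R ⟨hD.trans hDR, le_rfl⟩
  obtain ⟨L, hL⟩ : ∃ L, L = R - D := ⟨_, rfl⟩
  rw [← hL] at hsR
  have hL0 : 0 ≤ L := by linarith
  have hs0 := le_abs_self (s 0)
  have hφ0 := le_abs_self (φ 0)
  have hφD' : φ 0 * D ≤ |φ 0| * D := by gcongr
  have hsD' : s D ≤ |s 0| + |φ 0| * D + Δ * D ^ 2 / 2 := by linarith
  have hφD'' : φ D ≤ |φ 0| + Δ * D := by linarith
  have hcurv : |φ 0| + Δ * D + 1 ≤ k₂ 0 * L / 2 := by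
    have hLk : 2 * (|φ 0| + Δ * D + 1) / k₂ 0 ≤ L := by
      have : 0 ≤ |s 0| + |φ 0| * D + Δ * D ^ 2 / 2 := by positivity
      linarith
    rw [div_le_iff₀ hk₂] at hLk
    linarith
  have hSL : |s 0| + |φ 0| * D + Δ * D ^ 2 / 2 ≤ L := by
    have : 0 ≤ 2 * (|φ 0| + Δ * D + 1) / k₂ 0 := by positivity
    linarith
  nlinarith [mul_le_mul_of_nonneg_right hφD'' hL0, mul_le_mul_of_nonneg_right hcurv hL0]

theorem forall_le_or_forall_le_neg_of_le_abs {f : ℝ → ℝ} {a b ε : ℝ} (hε : 0 < ε)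
    (hf : ContinuousOn f (Icc a b)) (h : ∀ t ∈ Icc a b, ε ≤ |f t|) :
    (∀ t ∈ Icc a b, ε ≤ f t) ∨ ∀ t ∈ Icc a b, ε ≤ -f t := by
  by_contra! hcon
  obtain ⟨⟨u, hu, hfu⟩, v, hv, hfv⟩ := hcon
  have hu0 : f u ≤ 0 := by
    by_contra! hpos
    linarith [h u hu, abs_of_pos hpos]
  have hv0 : 0 ≤ f v := by
    by_contra! hneg
    linarith [h v hv, abs_of_neg hneg]
  obtain ⟨w, hw, hw0⟩ := isPreconnected_Icc.intermediate_value hu hv hf ⟨hu0, hv0⟩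
  have := h w hw
  rw [hw0, abs_zero] at this
  linarith


theorem proposition2 (α ε Δ : ℝ) (hα₀ : 0 < α) (hα₁ : α < 1) (hε : 0 < ε) (hΔ : 0 ≤ Δ)
    (s₀ φ₀ k₁₀ k₂₀ : ℝ) (hk₁₀ : 0 < k₁₀) (hk₂₀ : 0 < k₂₀) (M : ℝ) :
    ∃ T : ℝ, 0 ≤ T ∧
      ∀ δ s φ k₁ k₂ : ℝ → ℝ,
        (∀ t, 0 ≤ t → |δ t| ≤ Δ) →
        IsAdaptiveTrajectory α ε δ T s φ k₁ k₂ →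
        s 0 = s₀ → φ 0 = φ₀ → k₁ 0 = k₁₀ → k₂ 0 = k₂₀ →
        (0 < Δ → α < 1 / 2 →
          ∀ t ∈ Set.Icc 0 T, ε ≤ |s t| → |slidingRate α (s t) (φ t) (k₁ t)| ≤ M) →
        ∃ t ∈ Set.Icc 0 T, |s t| < ε := by
  have hT : 0 ≤ reachingTime Δ s₀ φ₀ k₂₀ M :=
    (dominationTime_nonneg s₀ φ₀ M hΔ hk₂₀).trans (dominationTime_le_reachingTime s₀ φ₀ M hΔ hk₂₀)
  refine ⟨reachingTime Δ s₀ φ₀ k₂₀ M, hT, ?_⟩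
  rintro δ s φ k₁ k₂ hδ h rfl rfl rfl rfl hM
  by_contra! hout
  have hcont := h.ac_s.continuousOn
  rw [uIcc_of_le hT] at hcont
  rcases forall_le_or_forall_le_neg_of_le_abs hε hcont hout with hpos | hneg
  · exact h.not_forall_le hα₀ hα₁ hε hΔ hδ hk₁₀ hk₂₀ hM hpos
  · have hRT : reachingTime Δ ((-s) 0) ((-φ) 0) (k₂ 0) M
        = reachingTime Δ (s 0) (φ 0) (k₂ 0) M := by
      simp only [reachingTime, dominationTime, Pi.neg_apply, abs_neg]
    have hn := h.neg
    rw [← hRT] at hn hneg hM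
    refine hn.not_forall_le hα₀ hα₁ hε hΔ (fun t ht => ?_) hk₁₀ hk₂₀ ?_ hneg
    · simpa only [Pi.neg_apply, abs_neg] using hδ t ht
    · simpa only [Pi.neg_apply, slidingRate_neg, abs_neg] using hM
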